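/- **($\alpha$-Acyclic Nerve Theorem).** Let $\mathbb{k}$ be a field, $T$ a totally ordered set with least element $0$, and $\alpha:T\to T$ a non-decreasing map with $t\le\alpha(t)$ for all $t\in T$. Let $\mathcal X^T=\{\mathcal X^t\}_{t\in T}$ be a filtered abstract simplicial complex ($\mathcal X^s\subseteq\mathcal X^t$ for $s\le t$) such that every $\mathcal X^t$ has vertex set $X$, and let $\mathcal U$ be a cover of $X$ by subsets. For $V\subseteq X$ let $\mathcal X^t(V)$ be the subcomplex of the simplices of $\mathcal X^t$ contained in $V$, and let the cover complex be $\mathcal X^t(\mathcal U)=\bigcup_{U\in\mathcal U}\mathcal X^t(U)$. Let $\overline{\mathcal U}$ be the set of all intersections of nonempty (finite or infinite) subfamilies of $\mathcal U$, and let the nerve $\mathcal N(\mathcal U)$ be the simplicial complex whose simplices are the finite nonempty subfamilies of $\mathcal U$ with nonempty intersection. Suppose that for every $V\in\overline{\mathcal U}$ the filtered complex $\mathcal X^T(V)$ is $\alpha$-acyclic: for all $t\in T$ and $q\ge 0$, every $q$-cycle of the augmented simplicial chain complex of $\mathcal X^t(V)$ with coefficients in $\mathbb{k}$ is the boundary of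 a $(q+1)$-chain of $\mathcal X^{\alpha(t)}(V)$. Then for every $k\ge 0$ the persistence vector spaces $H_k(\mathcal N(\mathcal U);\mathbb{k})$ (constant over $T$) and $H_k(\mathcal X^T(\mathcal U);\mathbb{k})$ are $(\alpha^{k+1},\mathrm{id})$-interleaved, where $\alpha^{k+1}$ is the $(k+1)$-fold iterate of $\alpha$. That is, there are linear maps $$F^t:H_k(\mathcal N(\mathcal U))\to H_k(\mathcal X^{\alpha^{k+1}(t)}(\mathcal U)),\qquad G^t:H_k(\mathcal X^t(\mathcal U))\to H_k(\mathcal N(\mathcal U))\qquad(t\in T),$$ commuting with the structure maps of the two persistence vector spaces, such that for every $t\in T$ the composite $G^{\alpha^{k+1}(t)}\circ F^t$ is the identity and $F^t\circ G^t$ is the map $H_k(\mathcal X^t(\mathcal U))\to H_k(\mathcal X^{\alpha^{k+1}(t)}(\mathcal U))$ induced by inclusion. -/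

import Mathlib

universe u v w

noncomputable section

namespace CoverNerve

/-- The subquotient `Z / (Z ∩ B)` of a module. -/
abbrev Subquotient {R : Type w} {M : Type u} [Ring R] [AddCommGroup M] [Module R M]
    (Z B : Submodule R M) : Type u :=
  Z ⧸ B.submoduleOf Z

/-- The map of subquotients induced by inclusions `Z ⊆ Z'` and `B ⊆ B'`. -/
def Subquotient.map {R : Type w} {M : Type u} [Ring R] [AddCommGroup M] [Module R M]
    {Z B Z' B' : Submodule R M} (hZ : Z ≤ Z') (hB : B ≤ B') :
    Subquotient Z B →ₗ[R] Subquotient Z' B' :=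
  Submodule.mapQ _ _ (Submodule.inclusion hZ) fun _ hz => hB hz

/-! ### Oriented simplicial chains and simplicial homology

The vertices of every simplex are listed in increasing order for a fixed well-ordering
of the vertex type, so that there is one basis chain for each simplex. -/

/-- The incidence sign `(-1) ^ i` of the `i`-th vertex `x` of the simplex `s`
(where `i` is the number of vertices of `s` that precede `x`). -/
def incidence (𝕜 : Type w) [Field 𝕜] {ι : Type u} (s : Finset ι) (x : ι) : 𝕜 :=
  open Classical in (-1) ^ (s.filter fun y => WellOrderingRel y x).card

/-- The boundary operator `∂ (x₀, …, xₙ) = ∑ i, (-1) ^ i (x₀, …, x̂ᵢ, …, xₙ)` on formal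
combinations of finite sets of vertices. As the empty set is allowed, this is the boundary of the
augmented complex: on `0`-chains it is the augmentation `∑ aₓ x ↦ (∑ aₓ) ∅`. -/
def boundary (𝕜 : Type w) [Field 𝕜] (ι : Type u) : (Finset ι →₀ 𝕜) →ₗ[𝕜] (Finset ι →₀ 𝕜) :=
  Finsupp.linearCombination 𝕜 fun s : Finset ι =>
    open Classical in ∑ x ∈ s, Finsupp.single (s.erase x) (incidence 𝕜 s x)

/-- The `n`-chains of a simplicial complex: combinations of its `n`-simplices. -/
def chains (𝕜 : Type w) [Field 𝕜] {ι : Type u} (K : PreAbstractSimplicialComplex ι) (n : ℕ) :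
    Submodule 𝕜 (Finset ι →₀ 𝕜) :=
  Finsupp.supported 𝕜 𝕜 {s : Finset ι | s ∈ K.faces ∧ s.card = n + 1}

/-- The `n`-cycles (not reduced: every `0`-chain is a cycle). -/
def cycles (𝕜 : Type w) [Field 𝕜] {ι : Type u} (K : PreAbstractSimplicialComplex ι) (n : ℕ) :
    Submodule 𝕜 (Finset ι →₀ 𝕜) :=
  chains 𝕜 K n ⊓ if n = 0 then ⊤ else LinearMap.ker (boundary 𝕜 ι)

/-- The `n`-boundaries. -/
def boundaries (𝕜 : Type w) [Field 𝕜] {ι : Type u} (K : PreAbstractSimplicialComplex ι) (n : ℕ) :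
    Submodule 𝕜 (Finset ι →₀ 𝕜) :=
  (chains 𝕜 K (n + 1)).map (boundary 𝕜 ι)

theorem chains_mono (𝕜 : Type w) [Field 𝕜] {ι : Type u} {K L : PreAbstractSimplicialComplex ι}
    (h : K ≤ L) (n : ℕ) : chains 𝕜 K n ≤ chains 𝕜 L n :=
  Finsupp.supported_mono fun _ hs => ⟨h hs.1, hs.2⟩

theorem cycles_mono (𝕜 : Type w) [Field 𝕜] {ι : Type u} {K L : PreAbstractSimplicialComplex ι}
    (h : K ≤ L) (n : ℕ) : cycles 𝕜 K n ≤ cycles 𝕜 L n :=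
  inf_le_inf_right _ (chains_mono 𝕜 h n)

theorem boundaries_mono (𝕜 : Type w) [Field 𝕜] {ι : Type u} {K L : PreAbstractSimplicialComplex ι}
    (h : K ≤ L) (n : ℕ) : boundaries 𝕜 K n ≤ boundaries 𝕜 L n :=
  Submodule.map_mono (chains_mono 𝕜 h (n + 1))

theorem boundary_boundary (𝕜 : Type w) [Field 𝕜] {ι : Type u} (z : Finset ι →₀ 𝕜) :
    boundary 𝕜 ι (boundary 𝕜 ι z) = 0 := by
  classical
  suffices h : boundary 𝕜 ι ∘ₗ boundary 𝕜 ι = 0 from LinearMap.congr_fun h z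
  have key : ∀ (s : Finset ι) (x y : ι), x ∈ s → WellOrderingRel x y →
      incidence 𝕜 s x * incidence 𝕜 (s.erase x) y
        + incidence 𝕜 s y * incidence 𝕜 (s.erase y) x = 0 := by
    intro s x y hx hxy
    have h1 : ((s.erase y).filter fun z => WellOrderingRel z x)
        = s.filter fun z => WellOrderingRel z x := by
      ext z
      simp only [Finset.mem_filter, Finset.mem_erase]
      refine ⟨fun h => ⟨h.1.2, h.2⟩, fun h => ⟨⟨?_, h.1⟩, h.2⟩⟩
      rintro rfl
      exact asymm_of WellOrderingRel h.2 hxy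
    have h2 : ((s.erase x).filter fun z => WellOrderingRel z y)
        = (s.filter fun z => WellOrderingRel z y).erase x := Finset.filter_erase _ _ _
    have h3 : x ∈ s.filter fun z => WellOrderingRel z y := Finset.mem_filter.2 ⟨hx, hxy⟩
    have h4 := Finset.card_erase_add_one h3
    simp only [incidence, h1, h2]
    rw [← h4, pow_succ]
    ring
  refine Finsupp.lhom_ext' fun s => LinearMap.ext_ring ?_
  simp only [boundary, LinearMap.comp_apply, Finsupp.lsingle_apply,
    Finsupp.linearCombination_single, one_smul, map_sum, LinearMap.zero_apply, Finset.smul_sum,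
    Finsupp.smul_single, smul_eq_mul]
  rw [Finset.sum_sigma']
  refine Finset.sum_involution (fun p _ => ⟨p.2, p.1⟩) ?_ ?_ ?_ ?_
  · rintro ⟨x, y⟩ h
    simp only [Finset.mem_sigma, Finset.mem_erase] at h
    rw [Finset.erase_right_comm, ← Finsupp.single_add]
    rcases trichotomous_of WellOrderingRel x y with hxy | hxy | hxy
    · rw [key s x y h.1 hxy, Finsupp.single_zero]
    · exact absurd hxy.symm h.2.1
    · rw [add_comm, key s y x h.2.2 hxy, Finsupp.single_zero]
  · rintro ⟨x, y⟩ h _ heq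
    simp only [Finset.mem_sigma, Finset.mem_erase] at h
    exact h.2.1 (congrArg Sigma.fst heq)
  · rintro ⟨x, y⟩ h
    simp only [Finset.mem_sigma, Finset.mem_erase] at h ⊢
    exact ⟨h.2.2, fun e => h.2.1 e.symm, h.1⟩
  · rintro ⟨x, y⟩ _
    rfl

theorem boundary_mem_chains (𝕜 : Type w) [Field 𝕜] {ι : Type u}
    (K : PreAbstractSimplicialComplex ι) (n : ℕ) {z : Finset ι →₀ 𝕜}
    (hz : z ∈ chains 𝕜 K (n + 1)) : boundary 𝕜 ι z ∈ chains 𝕜 K n := by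
  classical
  rw [boundary, Finsupp.linearCombination_apply]
  refine Submodule.sum_mem _ fun s hs => Submodule.smul_mem _ _ (Submodule.sum_mem _ fun x hx =>
    Finsupp.single_mem_supported 𝕜 _ ?_)
  obtain ⟨hsK, hc⟩ := hz hs
  have hce : (s.erase x).card = n + 1 := by rw [Finset.card_erase_of_mem hx, hc]; rfl
  exact ⟨(K.isRelLowerSet_faces hsK).2 (Finset.erase_subset x s)
    (Finset.card_pos.1 (by omega)), hce⟩

theorem boundaries_le_cycles (𝕜 : Type w) [Field 𝕜] {ι : Type u}
    (K : PreAbstractSimplicialComplex ι) (n : ℕ) : boundaries 𝕜 K n ≤ cycles 𝕜 K n := by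
  rintro _ ⟨z, hz, rfl⟩
  cases n with
  | zero => exact ⟨boundary_mem_chains 𝕜 K 0 hz, trivial⟩
  | succ n => exact ⟨boundary_mem_chains 𝕜 K (n + 1) hz, boundary_boundary 𝕜 z⟩

/-- The simplicial homology `H_n(K; 𝕜)`: cycles modulo boundaries. -/
abbrev Homology (𝕜 : Type w) [Field 𝕜] {ι : Type u} (K : PreAbstractSimplicialComplex ι) (n : ℕ) :
    Type (max u w) :=
  Subquotient (cycles 𝕜 K n) (boundaries 𝕜 K n)

/-- The map `H_n(K) → H_n(L)` induced by an inclusion `K ⊆ L`. -/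
def homologyMap (𝕜 : Type w) [Field 𝕜] {ι : Type u} {K L : PreAbstractSimplicialComplex ι}
    (h : K ≤ L) (n : ℕ) : Homology 𝕜 K n →ₗ[𝕜] Homology 𝕜 L n :=
  Subquotient.map (cycles_mono 𝕜 h n) (boundaries_mono 𝕜 h n)

/-! ### Persistent homology and interleavings -/

/-- The persistence vector space `H_n(K^T)` of a filtered simplicial complex. -/
def persistentHomology (𝕜 : Type w) [Field 𝕜] {ι : Type u} {T : Type v} [Preorder T]
    (K : T →o PreAbstractSimplicialComplex ι) (n : ℕ) :
    CategoryTheory.Functor T (ModuleCat.{max u w} 𝕜) where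
  obj t := ModuleCat.of 𝕜 (Homology 𝕜 (K t) n)
  map f := ModuleCat.ofHom (homologyMap 𝕜 (K.monotone f.le) n)
  map_id t := by
    ext z
    rfl
  map_comp f g := by
    ext z
    rfl

/-- `V` and `W` are `(α, β)`-interleaved: there are an `α`-shift map `F : V → W` and a `β`-shift
map `G : W → V` whose composites are the self-shift maps of `V` and `W`. -/
def Interleaved {𝕜 : Type w} [Field 𝕜] {S T : Type v} [Preorder S] [Preorder T]
    (α : S → T) (β : T → S) (V : CategoryTheory.Functor S (ModuleCat.{max u w} 𝕜))
    (W : CategoryTheory.Functor T (ModuleCat.{max u w} 𝕜)) : Prop :=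
  ∃ (hα : Monotone α) (hβ : Monotone β) (hβα : ∀ s, s ≤ β (α s)) (hαβ : ∀ t, t ≤ α (β t))
    (F : V ⟶ hα.functor.comp W) (G : W ⟶ hβ.functor.comp V),
    (∀ s, CategoryTheory.CategoryStruct.comp (F.app s) (G.app (α s))
      = V.map (CategoryTheory.homOfLE (hβα s))) ∧
    (∀ t, CategoryTheory.CategoryStruct.comp (G.app t) (F.app (β t))
      = W.map (CategoryTheory.homOfLE (hαβ t)))

/-- A filtered complex is `α`-acyclic if every (reduced) cycle of degree `q ≥ 0` at parameter `t`
is the boundary of a chain at parameter `α t`. -/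
def AlphaAcyclic (𝕜 : Type w) [Field 𝕜] {ι : Type u} {T : Type v} [Preorder T] (α : T → T)
    (K : T →o PreAbstractSimplicialComplex ι) : Prop :=
  ∀ (t : T) (q : ℕ), ∀ z ∈ chains 𝕜 (K t) q, boundary 𝕜 ι z = 0 →
    ∃ y ∈ chains 𝕜 (K (α t)) (q + 1), boundary 𝕜 ι y = z

/-! ### Covers -/

/-- The intersections of all nonempty (finite or infinite) subfamilies of `𝒰`. -/
def interClosure {X : Type u} (𝒰 : Set (Set X)) : Set (Set X) :=
  {V | ∃ 𝒮 ⊆ 𝒰, 𝒮.Nonempty ∧ V = ⋂₀ 𝒮}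

/-- The nerve of `𝒰`: its simplices are the finite nonempty subfamilies of `𝒰` with a common
point. -/
def nerve {X : Type u} (𝒰 : Set (Set X)) : PreAbstractSimplicialComplex (Set X) where
  faces := {σ | σ.Nonempty ∧ (σ : Set (Set X)) ⊆ 𝒰 ∧ (⋂₀ (σ : Set (Set X))).Nonempty}
  isRelLowerSet_faces := fun {_} h => ⟨h.1, fun _ hτ hne =>
    ⟨hne, fun _ hU => h.2.1 (hτ hU), h.2.2.mono (Set.sInter_subset_sInter fun _ hU => hτ hU)⟩⟩

/-- The cover complex `K^T(𝒰)`: the simplices of the filtered complex `K^T`, with vertex set `X`,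
that lie in some member of `𝒰`. -/
def coverComplex {X : Type u} {T : Type v} [Preorder T] (K : T →o AbstractSimplicialComplex X)
    (𝒰 : Set (Set X)) : T →o PreAbstractSimplicialComplex X where
  toFun t :=
    { faces := {s | s ∈ (K t).faces ∧ ∃ U ∈ 𝒰, (s : Set X) ⊆ U}
      isRelLowerSet_faces := fun {_} h => ⟨((K t).isRelLowerSet_faces h.1).1, fun _ hr hne =>
        ⟨((K t).isRelLowerSet_faces h.1).2 hr hne, h.2.imp fun _ hU =>
          ⟨hU.1, fun _ hx => hU.2 (hr hx)⟩⟩⟩ }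
  monotone' _ _ h _ hs := ⟨K.monotone h hs.1, hs.2⟩

/-- The restriction `K^T(V)` of the filtered complex `K^T` to the simplices contained in `V`. -/
def restriction {X : Type u} {T : Type v} [Preorder T] (K : T →o AbstractSimplicialComplex X)
    (V : Set X) : T →o PreAbstractSimplicialComplex X :=
  coverComplex K {V}

end CoverNerve

end

noncomputable section

namespace CoverNerve

/-! ### Linear maps of subquotients induced by linear relations -/

/-! Consider the double complex spanned by pairs `(s, σ)` with `s` a simplex or empty, `σ` a finite
subfamily of `𝒰` and `s ⊆ ⋂₀ σ`, graded by cardinalities and hence augmented in both directions. Its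
edge `s = ∅` is the chain complex of the nerve, its edge `σ = ∅` that of the cover complex.

For fixed `s ≠ ∅` the sets `σ` span a full simplex on the members of `𝒰` containing `s`, so the
second differential is exact at each fixed filtration level (`coverDoubleComplex_rightExact`). For
fixed `σ ≠ ∅` one sees the augmented complex of the restriction to `⋂₀ σ`, so the first differential
is exact up to a shift by `α`; no shift is needed at the augmentation, since every point is a vertex
at every level (`coverDoubleComplex_leftExact`).

Staircases through the double complex define one linear relation between chains of the two edges.
Exactness extends a cycle on either edge to a staircase and shows that a staircase starting at a
boundary ends at a boundary, so the relation induces both `F` and, read backwards, `G`. A staircase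
showing `F [n] = [x]` also shows `G [x] = [n]` after raising its levels, and conversely; hence the
composites and naturality need no further construction. From the nerve edge in degree `k` a
staircase ends at level `α^k t`; bounding its end costs one more step, which gives `α^(k+1)`. -/

theorem Subquotient.exists_map_of_relation {R : Type w} {M M' : Type*} [Ring R] [AddCommGroup M]
    [Module R M] [AddCommGroup M'] [Module R M'] (Z B : Submodule R M) (Z' B' : Submodule R M')
    (r : Submodule R (M × M'))
    (hex : ∀ z ∈ Z, ∃ z' ∈ Z', (z, z') ∈ r)
    (hB : ∀ z z', (z, z') ∈ r → z ∈ B → z' ∈ B') :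
    ∃ f : Subquotient Z B →ₗ[R] Subquotient Z' B', ∀ (z : Z) (z' : Z'), (z.1, z'.1) ∈ r →
      f (Submodule.Quotient.mk z) = Submodule.Quotient.mk z' := by
  choose c hcZ hcr using hex
  have huniq : ∀ (z : Z) (z₁ z₂ : Z'), (z.1, z₁.1) ∈ r → (z.1, z₂.1) ∈ r →
      (Submodule.Quotient.mk z₁ : Subquotient Z' B') = Submodule.Quotient.mk z₂ := by
    intro z z₁ z₂ h₁ h₂
    -- The difference of two values is related to `0 ∈ B`, so it lies in `B'`.
    refine (Submodule.Quotient.eq _).2 (hB 0 _ ?_ B.zero_mem)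
    simpa using r.sub_mem h₁ h₂
  let g : Z →ₗ[R] Subquotient Z' B' :=
    { toFun := fun z => Submodule.Quotient.mk ⟨c z.1 z.2, hcZ _ _⟩
      map_add' := fun z₁ z₂ => by
        rw [← Submodule.Quotient.mk_add]
        exact huniq (z₁ + z₂) _ _ (hcr _ _) (r.add_mem (hcr _ z₁.2) (hcr _ z₂.2))
      map_smul' := fun a z => by
        rw [RingHom.id_apply, ← Submodule.Quotient.mk_smul]
        exact huniq (a • z) _ _ (hcr _ _) (r.smul_mem a (hcr _ z.2)) }
  have hg : B.submoduleOf Z ≤ LinearMap.ker g := fun z hz =>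
    (Submodule.Quotient.mk_eq_zero _).2 (hB _ _ (hcr _ z.2) hz)
  exact ⟨Submodule.liftQ _ g hg, fun z z' h => huniq z _ _ (hcr _ _) h⟩

/-! ### Zigzags in filtered double complexes -/

/-- A filtered double complex with commuting differentials inside an ambient module. -/
structure FilteredDoubleComplex (𝕜 : Type w) [Field 𝕜] (T : Type v) [Preorder T] (D : Type u)
    [AddCommGroup D] [Module 𝕜 D] where
  /-- the first differential -/
  dL : D →ₗ[𝕜] D
  /-- the second differential -/
  dR : D →ₗ[𝕜] D
  /-- the part of a given bidegree at a given filtration level -/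
  part : T → ℕ → ℕ → Submodule 𝕜 D
  part_mono : ∀ {s t : T} (a b : ℕ), s ≤ t → part s a b ≤ part t a b
  dL_dL : ∀ z, dL (dL z) = 0
  dR_dR : ∀ z, dR (dR z) = 0
  dL_dR : ∀ z, dL (dR z) = dR (dL z)
  dL_mem : ∀ {t a b z}, z ∈ part t (a + 1) b → dL z ∈ part t a b
  dR_mem : ∀ {t a b z}, z ∈ part t a (b + 1) → dR z ∈ part t a b
  dL_eq_zero : ∀ {t b z}, z ∈ part t 0 b → dL z = 0
  dR_eq_zero : ∀ {t a z}, z ∈ part t a 0 → dR z = 0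

namespace FilteredDoubleComplex

variable {𝕜 : Type w} [Field 𝕜] {T : Type v} [Preorder T] {D : Type u} [AddCommGroup D]
  [Module 𝕜 D] (C : FilteredDoubleComplex 𝕜 T D)

/-- `C.Zigzag L m i z x` means that `z` in bidegree `(i, m)` and `x` in bidegree `(i + m, 0)` are
linked by a staircase `z = dL d₀`, `dR d₀ = dL d₁`, …, `dR dₘ₋₁ = x`, where the step `dⱼ` has
bidegree `(i + j + 1, m - j)` and filtration level `L (i + j + 1)`. -/
def Zigzag (L : ℕ → T) : ℕ → ℕ → D → D → Prop
  | 0, _, z, x => z = x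
  | m + 1, i, z, x => ∃ d ∈ C.part (L (i + 1)) (i + 1) (m + 1), C.dL d = z ∧
      Zigzag L m (i + 1) (C.dR d) x

variable {C} {L L' : ℕ → T}

theorem Zigzag.add : ∀ {m i : ℕ} {z z' x x' : D}, C.Zigzag L m i z x → C.Zigzag L m i z' x' →
    C.Zigzag L m i (z + z') (x + x')
  | 0, _, _, _, _, _, h, h' => congrArg₂ (· + ·) h h'
  | _ + 1, _, _, _, _, _, ⟨d, hd, hz, h⟩, ⟨d', hd', hz', h'⟩ =>
    ⟨d + d', Submodule.add_mem _ hd hd', by rw [map_add, hz, hz'], by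
      rw [map_add]; exact h.add h'⟩

theorem Zigzag.smul (c : 𝕜) : ∀ {m i : ℕ} {z x : D}, C.Zigzag L m i z x →
    C.Zigzag L m i (c • z) (c • x)
  | 0, _, _, _, h => congrArg (c • ·) h
  | _ + 1, _, _, _, ⟨d, hd, hz, h⟩ =>
    ⟨c • d, Submodule.smul_mem _ c hd, by rw [map_smul, hz], by rw [map_smul]; exact h.smul c⟩

theorem Zigzag.zero : ∀ {m i : ℕ}, C.Zigzag L m i 0 0
  | 0, _ => rfl
  | _ + 1, _ => ⟨0, Submodule.zero_mem _, map_zero _, by rw [map_zero]; exact Zigzag.zero⟩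

theorem Zigzag.mono : ∀ {m i : ℕ} {z x : D}, (∀ j ≤ i + m, L j ≤ L' j) → C.Zigzag L m i z x →
    C.Zigzag L' m i z x
  | 0, _, _, _, _, h => h
  | _ + 1, _, _, _, hL, ⟨d, hd, hz, h⟩ =>
    ⟨d, C.part_mono _ _ (hL _ (by omega)) hd, hz, h.mono fun _ hj => hL _ (by omega)⟩

/-- With two steps, `dR z = dR (dL d) = dL (dR d) = dL (dL d') = 0`. A staircase with a single step,
which is the case of degree `0`, imposes no such condition. -/
theorem Zigzag.dR_left {m i : ℕ} {z x : D} (h : C.Zigzag L (m + 2) i z x) : C.dR z = 0 := by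
  obtain ⟨d, -, rfl, d', -, hd', -⟩ := h
  rw [← C.dL_dR, ← hd', C.dL_dL]

/-- Only the last step matters: there `dL x = dL (dR d) = dR (dL d)`, which vanishes by `dR_dR` if a
step precedes it and by the hypothesis on `z` otherwise. -/
theorem Zigzag.dL_right : ∀ {m i : ℕ} {z x : D}, C.dR z = 0 → C.Zigzag L (m + 1) i z x →
    C.dL x = 0
  | 0, _, _, _, hz, ⟨d, _, hd, h⟩ => by
    rw [← show C.dR d = _ from h, C.dL_dR, hd, hz]
  | _ + 1, _, _, _, _, ⟨_, _, _, h⟩ => h.dL_right (C.dR_dR _)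

variable (C) (L) in
/-- Solvability of `dL y = z` with `y` one filtration level higher in `L`. -/
def LeftExact : Prop :=
  ∀ i b, ∀ z ∈ C.part (L i) i (b + 1), C.dL z = 0 →
    ∃ y ∈ C.part (L (i + 1)) (i + 1) (b + 1), C.dL y = z

variable (C) in
/-- Exactness of the second differential away from the first row. -/
def RightExact : Prop :=
  ∀ t a b, ∀ z ∈ C.part t (a + 1) b, C.dR z = 0 → ∃ y ∈ C.part t (a + 1) (b + 1), C.dR y = z

/-- Lift along `dL`, apply `dR`, repeat; commutation makes the next element a `dL`-cycle. The
condition on `dR z` is needed only if a second lift follows, in accordance with every `0`-chain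
being a cycle. -/
theorem LeftExact.exists_zigzag (hC : C.LeftExact L) : ∀ {m i : ℕ} {z : D},
    z ∈ C.part (L i) i m → C.dL z = 0 → (2 ≤ m → C.dR z = 0) →
      ∃ x ∈ C.part (L (i + m)) (i + m) 0, C.Zigzag L m i z x
  | 0, _, z, hz, _, _ => ⟨z, hz, rfl⟩
  | m + 1, i, z, hz, hL, hR => by
    obtain ⟨d, hd, rfl⟩ := hC i m z hz hL
    have hdR : 1 ≤ m → C.dL (C.dR d) = 0 := fun hm => by rw [C.dL_dR, hR (by omega)]
    cases m with
    | zero => exact ⟨C.dR d, C.dR_mem hd, d, hd, rfl, rfl⟩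
    | succ m =>
      obtain ⟨x, hx, h⟩ := hC.exists_zigzag (C.dR_mem hd) (hdR (by omega)) fun _ => C.dR_dR d
      have e : i + 1 + (m + 1) = i + (m + 1 + 1) := by omega
      exact ⟨x, e ▸ hx, d, hd, rfl, h⟩

/-- Write `e = dL f`. Then `d - dR f` is a `dL`-cycle with the same `dR` as `d`, so it plays the
role of `e` for the staircase without its first step. The last lift raises the level once beyond the
end of the staircase. -/
theorem LeftExact.exists_dL_eq (hC : C.LeftExact L) : ∀ {m i : ℕ} {z x e : D},
    C.Zigzag L m i z x → e ∈ C.part (L i) i (m + 1) → C.dL e = 0 → C.dR e = z →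
      ∃ y ∈ C.part (L (i + m + 1)) (i + m + 1) 0, C.dL y = x
  | 0, i, z, x, e, h, he, hL, hR => by
    obtain ⟨f, hf, rfl⟩ := hC i 0 e he hL
    exact ⟨C.dR f, C.dR_mem hf, by rw [C.dL_dR, hR]; exact h⟩
  | m + 1, i, z, x, e, ⟨d, hd, hz, h⟩, he, hL, hR => by
    obtain ⟨f, hf, rfl⟩ := hC i (m + 1) e he hL
    have h1 : C.dL (d - C.dR f) = 0 := by rw [map_sub, C.dL_dR, hz, hR, sub_self]
    have h2 : C.dR (d - C.dR f) = C.dR d := by rw [map_sub, C.dR_dR, sub_zero]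
    have e : i + 1 + m + 1 = i + (m + 1) + 1 := by omega
    exact e ▸ hC.exists_dL_eq h (Submodule.sub_mem _ hd (C.dR_mem hf)) h1 h2

/-- The staircase is prolonged at its beginning: lift `z` along `dR` and apply `dL`, until the edge
`a = 0` is reached. -/
theorem RightExact.exists_zigzag (hC : C.RightExact) {t : T} : ∀ {i m : ℕ} {z x : D},
    z ∈ C.part t i m → C.dR z = 0 → (2 ≤ i → C.dL z = 0) → C.Zigzag (fun _ => t) m i z x →
      ∃ n ∈ C.part t 0 (m + i), C.Zigzag (fun _ => t) (m + i) 0 n x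
  | 0, _, z, _, hz, _, _, h => ⟨z, hz, h⟩
  | i + 1, m, z, x, hz, hR, hL, h => by
    obtain ⟨d, hd, rfl⟩ := hC t i m z hz hR
    have h' : C.Zigzag (fun _ => t) (m + 1) i (C.dL d) x := ⟨d, hd, rfl, h⟩
    have hdL : 1 ≤ i → C.dR (C.dL d) = 0 := fun hi => by rw [← C.dL_dR, hL (by omega)]
    cases i with
    | zero => exact ⟨C.dL d, C.dL_mem hd, h'⟩
    | succ i =>
      have e : m + 1 + (i + 1) = m + (i + 1 + 1) := by omega
      exact e ▸ hC.exists_zigzag (C.dL_mem hd) (hdL (by omega)) (fun _ => C.dL_dL d) h'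

/-- Induction from the far end. If `f = dR g` solves the problem for the staircase without its first
step, then `d - dL g` solves it for the whole. -/
theorem RightExact.exists_dL_eq (hC : C.RightExact) {t : T} : ∀ {m i : ℕ} {z x y : D},
    C.Zigzag (fun _ => t) m i z x → y ∈ C.part t (i + m + 1) 0 → C.dL y = x →
      ∃ f ∈ C.part t (i + 1) m, C.dR f = 0 ∧ C.dL f = z
  | 0, _, _, _, y, h, hy, hx => ⟨y, hy, C.dR_eq_zero hy, hx.trans (Eq.symm h)⟩
  | m + 1, i, z, x, y, ⟨d, hd, hz, h⟩, hy, hx => by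
    have e : i + (m + 1) + 1 = i + 1 + m + 1 := by omega
    obtain ⟨f, hf, hfR, hfL⟩ := hC.exists_dL_eq h (e ▸ hy) hx
    obtain ⟨g, hg, rfl⟩ := hC t (i + 1) m f hf hfR
    refine ⟨d - C.dL g, Submodule.sub_mem _ hd (C.dL_mem hg), ?_, ?_⟩
    · rw [map_sub, ← C.dL_dR, hfL, sub_self]
    · rw [map_sub, C.dL_dL, sub_zero, hz]

theorem RightExact.exists_dR_eq (hC : C.RightExact) {t : T} {m : ℕ} {z x y : D}
    (h : C.Zigzag (fun _ => t) m 0 z x) (hy : y ∈ C.part t (m + 1) 0) (hx : C.dL y = x) :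
    ∃ n ∈ C.part t 0 (m + 1), C.dR n = z := by
  obtain ⟨f, hf, hfR, rfl⟩ := hC.exists_dL_eq h (by rwa [Nat.zero_add]) hx
  obtain ⟨g, hg, rfl⟩ := hC t 0 m f hf hfR
  exact ⟨C.dL g, C.dL_mem hg, (C.dL_dR g).symm⟩

end FilteredDoubleComplex

/-! ### Simplicial boundary and cones -/

theorem boundary_single (𝕜 : Type w) [Field 𝕜] {ι : Type u} [DecidableEq ι] (s : Finset ι)
    (c : 𝕜) : boundary 𝕜 ι (Finsupp.single s c) =
      ∑ x ∈ s, (c * incidence 𝕜 s x) • Finsupp.single (s.erase x) 1 := by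
  classical
  rw [boundary, Finsupp.linearCombination_single, Finset.smul_sum]
  refine Finset.sum_congr rfl fun x _ => ?_
  rw [Finsupp.smul_single, Finsupp.smul_single, smul_eq_mul, smul_eq_mul, mul_one]
  congr!

theorem incidence_mul_self (𝕜 : Type w) [Field 𝕜] {ι : Type u} (s : Finset ι) (x : ι) :
    incidence 𝕜 s x * incidence 𝕜 s x = 1 := by
  rw [incidence, ← mul_pow]
  simp

/-- If `x` precedes `y`, deleting `x` lowers the position of `y` by one, while deleting `y` leaves
that of `x` unchanged. -/
theorem incidence_mul_incidence_erase (𝕜 : Type w) [Field 𝕜] {ι : Type u} [DecidableEq ι]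
    {s : Finset ι} {x y : ι} (hx : x ∈ s) (hy : y ∈ s) (hxy : x ≠ y) :
    incidence 𝕜 s x * incidence 𝕜 (s.erase x) y =
      -(incidence 𝕜 s y * incidence 𝕜 (s.erase y) x) := by
  classical
  wlog h : WellOrderingRel x y generalizing x y
  · have h' : WellOrderingRel y x := by
      rcases trichotomous_of WellOrderingRel x y with h1 | h1 | h1
      exacts [absurd h1 h, absurd h1 hxy, h1]
    rw [this hy hx hxy.symm h', neg_neg]
  have h1 : ((s.erase y).filter fun z => WellOrderingRel z x)
      = s.filter fun z => WellOrderingRel z x := by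
    ext z
    simp only [Finset.mem_filter, Finset.mem_erase]
    refine ⟨fun h => ⟨h.1.2, h.2⟩, fun h' => ⟨⟨?_, h'.1⟩, h'.2⟩⟩
    rintro rfl
    exact asymm_of WellOrderingRel h'.2 h
  have h2 : ((s.erase x).filter fun z => WellOrderingRel z y)
      = (s.filter fun z => WellOrderingRel z y).erase x := Finset.filter_erase _ _ _
  have h3 : x ∈ s.filter fun z => WellOrderingRel z y := Finset.mem_filter.2 ⟨hx, h⟩
  have h4 := Finset.card_erase_add_one h3
  have e1 : ∀ (r : Finset ι) (z : ι),
      incidence 𝕜 r z = (-1) ^ (r.filter fun y => WellOrderingRel y z).card := fun r z => by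
    rw [incidence]
  rw [e1, e1, e1, e1, h1, h2, ← h4, pow_succ]
  ring

/-- The cone operator with apex `v`, `(x₀, …, xₙ) ↦ (v, x₀, …, xₙ)` up to orientation. -/
def cone (𝕜 : Type w) [Field 𝕜] {ι : Type u} [DecidableEq ι] (v : ι) :
    (Finset ι →₀ 𝕜) →ₗ[𝕜] (Finset ι →₀ 𝕜) :=
  Finsupp.linearCombination 𝕜 fun s : Finset ι =>
    if v ∈ s then 0 else incidence 𝕜 (insert v s) v • Finsupp.single (insert v s) 1

theorem cone_single (𝕜 : Type w) [Field 𝕜] {ι : Type u} [DecidableEq ι] (v : ι) (s : Finset ι) :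
    cone 𝕜 v (Finsupp.single s 1) =
      if v ∈ s then 0 else incidence 𝕜 (insert v s) v • Finsupp.single (insert v s) 1 := by
  rw [cone, Finsupp.linearCombination_single, one_smul]

/-- The cone is a contracting homotopy. No correction in low degree appears, because the empty set
is a basis element. -/
theorem boundary_cone (𝕜 : Type w) [Field 𝕜] {ι : Type u} [DecidableEq ι] (v : ι)
    (z : Finset ι →₀ 𝕜) : boundary 𝕜 ι (cone 𝕜 v z) + cone 𝕜 v (boundary 𝕜 ι z) = z := by
  suffices h : boundary 𝕜 ι ∘ₗ cone 𝕜 v + cone 𝕜 v ∘ₗ boundary 𝕜 ι = LinearMap.id from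
    LinearMap.congr_fun h z
  refine Finsupp.lhom_ext' fun s => LinearMap.ext_ring ?_
  simp only [LinearMap.comp_apply, LinearMap.add_apply, Finsupp.lsingle_apply, LinearMap.id_apply,
    boundary_single, map_sum, map_smul, cone_single, one_mul]
  -- If `v ∈ s`, only the face opposite `v` survives the cone and returns `s`. Otherwise that face
  -- of the cone is `s`, and the remaining faces cancel in pairs.
  by_cases hv : v ∈ s
  · rw [if_pos hv, map_zero, zero_add, Finset.sum_eq_single_of_mem v hv]
    · rw [if_neg (Finset.notMem_erase v s), Finset.insert_erase hv, smul_smul,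
        incidence_mul_self, one_smul]
    · intro x _ hx
      rw [if_pos (Finset.mem_erase.2 ⟨hx.symm, hv⟩), smul_zero]
  · rw [if_neg hv, map_smul, boundary_single, Finset.sum_insert hv, Finset.erase_insert hv,
      smul_add, smul_smul, one_mul, incidence_mul_self, one_smul, add_assoc, Finset.smul_sum,
      ← Finset.sum_add_distrib, Finset.sum_eq_zero, add_zero]
    intro x hx
    have hxv : v ≠ x := fun e => hv (e ▸ hx)
    have e : insert v (s.erase x) = (insert v s).erase x :=
      (Finset.erase_insert_of_ne hxv).symm
    rw [if_neg fun h => hv (Finset.mem_of_mem_erase h), e, smul_smul, smul_smul, ← add_smul]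
    have key := incidence_mul_incidence_erase 𝕜 (Finset.mem_insert_self v s)
      (Finset.mem_insert_of_mem hx) hxv
    rw [Finset.erase_insert hv] at key
    have h1 := incidence_mul_self 𝕜 (insert v s) v
    have h2 := incidence_mul_self 𝕜 ((insert v s).erase x) v
    convert zero_smul 𝕜 _
    generalize incidence 𝕜 (insert v s) v = a at *
    generalize incidence 𝕜 ((insert v s).erase x) v = b at *
    -- The exchange relation is multiplied by the signs `a` and `b`, whose squares are `1`.
    linear_combination a * b * key - b * incidence 𝕜 s x * h1 -
      a * incidence 𝕜 (insert v s) x * h2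

theorem cone_mem_supported (𝕜 : Type w) [Field 𝕜] {ι : Type u} [DecidableEq ι] (v : ι)
    {S S' : Set (Finset ι)} (h : ∀ s ∈ S, v ∉ s → insert v s ∈ S') {z : Finset ι →₀ 𝕜}
    (hz : z ∈ Finsupp.supported 𝕜 𝕜 S) : cone 𝕜 v z ∈ Finsupp.supported 𝕜 𝕜 S' := by
  rw [cone, Finsupp.linearCombination_apply]
  refine Submodule.sum_mem _ fun s hs => Submodule.smul_mem _ _ ?_
  split_ifs with hv
  · exact Submodule.zero_mem _
  · exact Submodule.smul_mem _ _ (Finsupp.single_mem_supported 𝕜 _ (h s (hz hs) hv))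

/-! ### The double complex of pairs of simplices -/

section Pairs

variable (𝕜 : Type w) [Field 𝕜] {ι κ : Type u}

/-- The chain `m ⊗ σ`. -/
def tensorLeft (ι : Type u) (σ : Finset κ) :
    (Finset ι →₀ 𝕜) →ₗ[𝕜] (Finset ι × Finset κ →₀ 𝕜) :=
  Finsupp.lmapDomain 𝕜 𝕜 fun s => (s, σ)

/-- The chain `s ⊗ m`. -/
def tensorRight (κ : Type u) (s : Finset ι) :
    (Finset κ →₀ 𝕜) →ₗ[𝕜] (Finset ι × Finset κ →₀ 𝕜) :=
  Finsupp.lmapDomain 𝕜 𝕜 fun σ => (s, σ)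

/-- The boundary operator in the first factor. -/
def boundaryLeft (ι κ : Type u) :
    (Finset ι × Finset κ →₀ 𝕜) →ₗ[𝕜] (Finset ι × Finset κ →₀ 𝕜) :=
  Finsupp.linearCombination 𝕜 fun p =>
    tensorLeft 𝕜 ι p.2 (boundary 𝕜 ι (Finsupp.single p.1 1))

/-- The exchange of the two factors. -/
def swap (ι κ : Type u) : (Finset ι × Finset κ →₀ 𝕜) ≃ₗ[𝕜] (Finset κ × Finset ι →₀ 𝕜) :=
  Finsupp.domLCongr (Equiv.prodComm _ _)

/-- The boundary operator in the second factor. -/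
def boundaryRight (ι κ : Type u) :
    (Finset ι × Finset κ →₀ 𝕜) →ₗ[𝕜] (Finset ι × Finset κ →₀ 𝕜) :=
  (swap 𝕜 κ ι).toLinearMap ∘ₗ boundaryLeft 𝕜 κ ι ∘ₗ (swap 𝕜 ι κ).toLinearMap

variable {𝕜}

theorem tensorLeft_single (σ : Finset κ) (s : Finset ι) (c : 𝕜) :
    tensorLeft 𝕜 ι σ (Finsupp.single s c) = Finsupp.single (s, σ) c :=
  Finsupp.mapDomain_single

theorem tensorRight_single (s : Finset ι) (σ : Finset κ) (c : 𝕜) :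
    tensorRight 𝕜 κ s (Finsupp.single σ c) = Finsupp.single (s, σ) c :=
  Finsupp.mapDomain_single

theorem tensorLeft_injective (σ : Finset κ) : Function.Injective (tensorLeft 𝕜 ι σ) :=
  Finsupp.mapDomain_injective fun _ _ h => congrArg Prod.fst h

theorem tensorRight_injective (s : Finset ι) : Function.Injective (tensorRight 𝕜 κ s) :=
  Finsupp.mapDomain_injective fun _ _ h => congrArg Prod.snd h

theorem swap_single (s : Finset ι) (σ : Finset κ) (c : 𝕜) :
    swap 𝕜 ι κ (Finsupp.single (s, σ) c) = Finsupp.single (σ, s) c :=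
  Finsupp.domLCongr_single _ _ _

theorem swap_swap (z : Finset ι × Finset κ →₀ 𝕜) : swap 𝕜 κ ι (swap 𝕜 ι κ z) = z :=
  (swap 𝕜 ι κ).symm_apply_apply z

theorem swap_tensorLeft (s : Finset ι) (m : Finset κ →₀ 𝕜) :
    swap 𝕜 κ ι (tensorLeft 𝕜 κ s m) = tensorRight 𝕜 κ s m := by
  suffices h : (swap 𝕜 κ ι).toLinearMap ∘ₗ tensorLeft 𝕜 κ s = tensorRight 𝕜 κ s from
    LinearMap.congr_fun h m
  refine Finsupp.lhom_ext' fun σ => LinearMap.ext_ring ?_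
  simp [tensorLeft_single, tensorRight_single, swap_single]

theorem swap_tensorRight (s : Finset ι) (m : Finset κ →₀ 𝕜) :
    swap 𝕜 ι κ (tensorRight 𝕜 κ s m) = tensorLeft 𝕜 κ s m := by
  rw [← swap_tensorLeft, swap_swap]

theorem swap_mem_supported {S : Set (Finset ι × Finset κ)} {z : Finset ι × Finset κ →₀ 𝕜}
    (hz : z ∈ Finsupp.supported 𝕜 𝕜 S) :
    swap 𝕜 ι κ z ∈ Finsupp.supported 𝕜 𝕜 {p | p.swap ∈ S} := by
  rw [Finsupp.mem_supported'] at hz ⊢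
  exact fun p hp => hz p.swap hp

theorem boundaryLeft_tensorLeft (σ : Finset κ) (m : Finset ι →₀ 𝕜) :
    boundaryLeft 𝕜 ι κ (tensorLeft 𝕜 ι σ m) = tensorLeft 𝕜 ι σ (boundary 𝕜 ι m) := by
  suffices h : boundaryLeft 𝕜 ι κ ∘ₗ tensorLeft 𝕜 ι σ = tensorLeft 𝕜 ι σ ∘ₗ boundary 𝕜 ι from
    LinearMap.congr_fun h m
  refine Finsupp.lhom_ext' fun s => LinearMap.ext_ring ?_
  simp [tensorLeft_single, boundaryLeft]

theorem boundaryRight_tensorRight (s : Finset ι) (m : Finset κ →₀ 𝕜) :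
    boundaryRight 𝕜 ι κ (tensorRight 𝕜 κ s m) = tensorRight 𝕜 κ s (boundary 𝕜 κ m) := by
  simp [boundaryRight, swap_tensorRight, boundaryLeft_tensorLeft, swap_tensorLeft]

theorem boundaryLeft_boundaryLeft (z : Finset ι × Finset κ →₀ 𝕜) :
    boundaryLeft 𝕜 ι κ (boundaryLeft 𝕜 ι κ z) = 0 := by
  suffices h : boundaryLeft 𝕜 ι κ ∘ₗ boundaryLeft 𝕜 ι κ = 0 from LinearMap.congr_fun h z
  refine Finsupp.lhom_ext' fun p => LinearMap.ext_ring ?_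
  simp only [LinearMap.comp_apply, Finsupp.lsingle_apply, LinearMap.zero_apply]
  rw [← tensorLeft_single, boundaryLeft_tensorLeft, boundaryLeft_tensorLeft, boundary_boundary,
    map_zero]

theorem boundaryRight_boundaryRight (z : Finset ι × Finset κ →₀ 𝕜) :
    boundaryRight 𝕜 ι κ (boundaryRight 𝕜 ι κ z) = 0 := by
  simp [boundaryRight, swap_swap, boundaryLeft_boundaryLeft]

/-- The second factor enters only through `m`, so commutation of the two boundaries reduces to
linearity. -/
theorem boundaryLeft_tensorRight [DecidableEq ι] (s : Finset ι) (m : Finset κ →₀ 𝕜) :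
    boundaryLeft 𝕜 ι κ (tensorRight 𝕜 κ s m) =
      ∑ x ∈ s, incidence 𝕜 s x • tensorRight 𝕜 κ (s.erase x) m := by
  suffices h : boundaryLeft 𝕜 ι κ ∘ₗ tensorRight 𝕜 κ s =
      ∑ x ∈ s, incidence 𝕜 s x • tensorRight 𝕜 κ (s.erase x) by
    simpa using LinearMap.congr_fun h m
  refine Finsupp.lhom_ext' fun σ => LinearMap.ext_ring ?_
  simp only [LinearMap.comp_apply, Finsupp.lsingle_apply, LinearMap.sum_apply,
    LinearMap.smul_apply, tensorRight_single]
  rw [← tensorLeft_single, boundaryLeft_tensorLeft, boundary_single, map_sum]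
  simp only [one_mul, map_smul, tensorLeft_single]

theorem boundaryLeft_boundaryRight (z : Finset ι × Finset κ →₀ 𝕜) :
    boundaryLeft 𝕜 ι κ (boundaryRight 𝕜 ι κ z) = boundaryRight 𝕜 ι κ (boundaryLeft 𝕜 ι κ z) := by
  classical
  suffices h : boundaryLeft 𝕜 ι κ ∘ₗ boundaryRight 𝕜 ι κ =
      boundaryRight 𝕜 ι κ ∘ₗ boundaryLeft 𝕜 ι κ from LinearMap.congr_fun h z
  refine Finsupp.lhom_ext' fun p => LinearMap.ext_ring ?_
  simp only [LinearMap.comp_apply, Finsupp.lsingle_apply]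
  rw [← tensorRight_single, boundaryRight_tensorRight, boundaryLeft_tensorRight,
    boundaryLeft_tensorRight, map_sum]
  simp only [map_smul, boundaryRight_tensorRight]

theorem boundaryLeft_mem_supported {S S' : Set (Finset ι × Finset κ)} [DecidableEq ι]
    (h : ∀ s σ, (s, σ) ∈ S → ∀ x ∈ s, (s.erase x, σ) ∈ S') {z : Finset ι × Finset κ →₀ 𝕜}
    (hz : z ∈ Finsupp.supported 𝕜 𝕜 S) :
    boundaryLeft 𝕜 ι κ z ∈ Finsupp.supported 𝕜 𝕜 S' := by
  rw [boundaryLeft, Finsupp.linearCombination_apply]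
  refine Submodule.sum_mem _ fun p hp => Submodule.smul_mem _ _ ?_
  rw [boundary_single, map_sum]
  refine Submodule.sum_mem _ fun x hx => ?_
  rw [map_smul, tensorLeft_single]
  exact Submodule.smul_mem _ _ (Finsupp.single_mem_supported 𝕜 _ (h _ _ (hz hp) x hx))

theorem boundaryRight_mem_supported {S S' : Set (Finset ι × Finset κ)} [DecidableEq κ]
    (h : ∀ s σ, (s, σ) ∈ S → ∀ x ∈ σ, (s, σ.erase x) ∈ S') {z : Finset ι × Finset κ →₀ 𝕜}
    (hz : z ∈ Finsupp.supported 𝕜 𝕜 S) :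
    boundaryRight 𝕜 ι κ z ∈ Finsupp.supported 𝕜 𝕜 S' :=
  swap_mem_supported (boundaryLeft_mem_supported (S' := {p | p.swap ∈ S'})
    (fun _ _ hp x hx => h _ _ hp x hx) (swap_mem_supported hz))

/-! ### Slices of chains of pairs and slicewise exactness -/

variable (𝕜) in
/-- The coefficient chain of `σ` in a chain of pairs. -/
def sliceLeft (ι : Type u) (σ : Finset κ) :
    (Finset ι × Finset κ →₀ 𝕜) →ₗ[𝕜] (Finset ι →₀ 𝕜) :=
  Finsupp.lcomapDomain (fun s => (s, σ)) fun _ _ h => congrArg Prod.fst h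

theorem sliceLeft_apply (σ : Finset κ) (z : Finset ι × Finset κ →₀ 𝕜) (s : Finset ι) :
    sliceLeft 𝕜 ι σ z s = z (s, σ) := rfl

theorem tensorLeft_apply [DecidableEq κ] (σ τ : Finset κ) (m : Finset ι →₀ 𝕜) (s : Finset ι) :
    tensorLeft 𝕜 ι σ m (s, τ) = if τ = σ then m s else 0 := by
  split_ifs with h
  · subst h
    exact Finsupp.mapDomain_apply (fun _ _ h => congrArg Prod.fst h) m s
  · exact Finsupp.mapDomain_of_notMem_range _ _ fun ⟨_, hr⟩ => h (congrArg Prod.snd hr).symm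

theorem sum_tensorLeft_sliceLeft [DecidableEq κ] (z : Finset ι × Finset κ →₀ 𝕜) :
    ∑ σ ∈ z.support.image Prod.snd, tensorLeft 𝕜 ι σ (sliceLeft 𝕜 ι σ z) = z := by
  ext ⟨s, τ⟩
  rw [Finsupp.finsetSum_apply]
  simp only [tensorLeft_apply, sliceLeft_apply]
  rw [Finset.sum_ite_eq, ite_eq_left_iff]
  intro h
  by_contra h0
  exact h (Finset.mem_image_of_mem Prod.snd (Finsupp.mem_support_iff.2 (Ne.symm h0)))

theorem sliceLeft_boundaryLeft (σ : Finset κ) (z : Finset ι × Finset κ →₀ 𝕜) :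
    sliceLeft 𝕜 ι σ (boundaryLeft 𝕜 ι κ z) = boundary 𝕜 ι (sliceLeft 𝕜 ι σ z) := by
  classical
  have key : ∀ (τ : Finset κ) (m : Finset ι →₀ 𝕜),
      sliceLeft 𝕜 ι σ (tensorLeft 𝕜 ι τ m) = if σ = τ then m else 0 := by
    intro τ m
    ext s
    rw [sliceLeft_apply, tensorLeft_apply]
    split_ifs <;> rfl
  suffices h : sliceLeft 𝕜 ι σ ∘ₗ boundaryLeft 𝕜 ι κ = boundary 𝕜 ι ∘ₗ sliceLeft 𝕜 ι σ from
    LinearMap.congr_fun h z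
  refine Finsupp.lhom_ext' fun p => LinearMap.ext_ring ?_
  simp only [LinearMap.comp_apply, Finsupp.lsingle_apply]
  rw [← tensorLeft_single, boundaryLeft_tensorLeft, key, key]
  split_ifs
  · rfl
  · rw [map_zero]

/-- The left boundary acts on each slice `σ` separately and only finitely many slices are nonzero,
so solutions in the slices add up to a solution. -/
theorem exists_boundaryLeft_eq {S S' : Set (Finset ι × Finset κ)}
    (h : ∀ σ, ∀ m ∈ Finsupp.supported 𝕜 𝕜 {s | (s, σ) ∈ S}, boundary 𝕜 ι m = 0 →
      ∃ y ∈ Finsupp.supported 𝕜 𝕜 {s | (s, σ) ∈ S'}, boundary 𝕜 ι y = m)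
    {z : Finset ι × Finset κ →₀ 𝕜} (hz : z ∈ Finsupp.supported 𝕜 𝕜 S)
    (h0 : boundaryLeft 𝕜 ι κ z = 0) :
    ∃ y ∈ Finsupp.supported 𝕜 𝕜 S', boundaryLeft 𝕜 ι κ y = z := by
  classical
  have h' : ∀ σ, ∃ y ∈ Finsupp.supported 𝕜 𝕜 {s | (s, σ) ∈ S'},
      boundary 𝕜 ι y = sliceLeft 𝕜 ι σ z := fun σ => by
    refine h σ _ ?_ (by rw [← sliceLeft_boundaryLeft, h0, map_zero])
    rw [Finsupp.mem_supported'] at hz ⊢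
    exact fun s hs => hz _ hs
  choose y hyS hy using h'
  refine ⟨∑ σ ∈ z.support.image Prod.snd, tensorLeft 𝕜 ι σ (y σ),
    Submodule.sum_mem _ fun σ _ => ?_, ?_⟩
  · have := hyS σ
    rw [Finsupp.mem_supported'] at this ⊢
    rintro ⟨s, τ⟩ hp
    rw [tensorLeft_apply]
    split_ifs with e
    · exact this s (e ▸ hp)
    · rfl
  · conv_rhs => rw [← sum_tensorLeft_sliceLeft z]
    rw [map_sum]
    exact Finset.sum_congr rfl fun σ _ => by rw [boundaryLeft_tensorLeft, hy]

theorem exists_boundaryRight_eq {S S' : Set (Finset ι × Finset κ)}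
    (h : ∀ s, ∀ m ∈ Finsupp.supported 𝕜 𝕜 {σ | (s, σ) ∈ S}, boundary 𝕜 κ m = 0 →
      ∃ y ∈ Finsupp.supported 𝕜 𝕜 {σ | (s, σ) ∈ S'}, boundary 𝕜 κ y = m)
    {z : Finset ι × Finset κ →₀ 𝕜} (hz : z ∈ Finsupp.supported 𝕜 𝕜 S)
    (h0 : boundaryRight 𝕜 ι κ z = 0) :
    ∃ y ∈ Finsupp.supported 𝕜 𝕜 S', boundaryRight 𝕜 ι κ y = z := by
  obtain ⟨y, hy, e⟩ := exists_boundaryLeft_eq (S' := {p | p.swap ∈ S'}) h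
    (swap_mem_supported hz) ((swap 𝕜 κ ι).map_eq_zero_iff.1 h0)
  refine ⟨swap 𝕜 κ ι y, swap_mem_supported hy, ?_⟩
  simp [boundaryRight, swap_swap, e]

end Pairs

/-! ### Cycles, and chains of pairs concentrated in one slice -/

theorem mem_cycles_iff {𝕜 : Type w} [Field 𝕜] {ι : Type u} {K : PreAbstractSimplicialComplex ι}
    {n : ℕ} {z : Finset ι →₀ 𝕜} :
    z ∈ cycles 𝕜 K n ↔ z ∈ chains 𝕜 K n ∧ (n ≠ 0 → boundary 𝕜 ι z = 0) := by
  rw [cycles, Submodule.mem_inf]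
  split_ifs with h <;> simp [h]

theorem tensorLeft_sliceLeft {𝕜 : Type w} [Field 𝕜] {ι κ : Type u}
    {S : Set (Finset ι × Finset κ)} {σ : Finset κ} (hS : ∀ p ∈ S, p.2 = σ)
    {z : Finset ι × Finset κ →₀ 𝕜} (hz : z ∈ Finsupp.supported 𝕜 𝕜 S) :
    tensorLeft 𝕜 ι σ (sliceLeft 𝕜 ι σ z) = z := by
  classical
  ext ⟨s, τ⟩
  rw [tensorLeft_apply, sliceLeft_apply]
  split_ifs with h
  · rw [h]
  · exact ((Finsupp.mem_supported' 𝕜 z).1 hz _ fun hp => h (hS _ hp)).symm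

theorem tensorLeft_mem_supported_iff {𝕜 : Type w} [Field 𝕜] {ι κ : Type u}
    {S : Set (Finset ι × Finset κ)} {σ : Finset κ} {m : Finset ι →₀ 𝕜} :
    tensorLeft 𝕜 ι σ m ∈ Finsupp.supported 𝕜 𝕜 S ↔
      m ∈ Finsupp.supported 𝕜 𝕜 {s | (s, σ) ∈ S} := by
  classical
  simp only [Finsupp.mem_supported', Prod.forall, tensorLeft_apply]
  refine ⟨fun h s hs => by simpa using h s σ hs, fun h s τ hs => ?_⟩
  split_ifs with e
  · exact h s (e ▸ hs)
  · rfl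

theorem tensorRight_mem_supported_iff {𝕜 : Type w} [Field 𝕜] {ι κ : Type u}
    {S : Set (Finset ι × Finset κ)} {s : Finset ι} {m : Finset κ →₀ 𝕜} :
    tensorRight 𝕜 κ s m ∈ Finsupp.supported 𝕜 𝕜 S ↔
      m ∈ Finsupp.supported 𝕜 𝕜 {σ | (s, σ) ∈ S} := by
  rw [← swap_tensorLeft]
  refine Iff.trans ⟨fun h => ?_, swap_mem_supported (S := {p | p.swap ∈ S})⟩
    tensorLeft_mem_supported_iff
  simpa [swap_swap] using swap_mem_supported h

theorem exists_tensorRight_eq {𝕜 : Type w} [Field 𝕜] {ι κ : Type u}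
    {S : Set (Finset ι × Finset κ)} {s : Finset ι} (hS : ∀ p ∈ S, p.1 = s)
    {z : Finset ι × Finset κ →₀ 𝕜} (hz : z ∈ Finsupp.supported 𝕜 𝕜 S) :
    ∃ m, tensorRight 𝕜 κ s m = z := by
  refine ⟨sliceLeft 𝕜 κ s (swap 𝕜 ι κ z), ?_⟩
  rw [← swap_tensorLeft, tensorLeft_sliceLeft _ (swap_mem_supported hz), swap_swap]
  exact fun p hp => hS p.swap hp

/-! ### The double complex of a cover -/

section Cover

variable {X : Type u} {T : Type v}

/-- The pairs `(s, σ)` of finite sets with `a` and `b` elements, where `s` is empty or a simplex of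
`K` contained in a member of `𝒰`, `σ` is a subfamily of `𝒰` with a common point, and `s` lies in
every member of `σ`. -/
def pairs (K : AbstractSimplicialComplex X) (𝒰 : Set (Set X)) (a b : ℕ) :
    Set (Finset X × Finset (Set X)) :=
  {p | (p.1 = ∅ ∨ p.1 ∈ K.faces) ∧ (∃ U ∈ 𝒰, (p.1 : Set X) ⊆ U) ∧ (p.2 : Set (Set X)) ⊆ 𝒰 ∧
    (⋂₀ (p.2 : Set (Set X))).Nonempty ∧ (p.1 : Set X) ⊆ ⋂₀ (p.2 : Set (Set X)) ∧
    p.1.card = a ∧ p.2.card = b}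

variable {K : AbstractSimplicialComplex X} {𝒰 : Set (Set X)}

theorem erase_left_mem_pairs [DecidableEq X] {a b : ℕ} {s : Finset X} {σ : Finset (Set X)}
    (h : (s, σ) ∈ pairs K 𝒰 (a + 1) b) {x : X} (hx : x ∈ s) :
    (s.erase x, σ) ∈ pairs K 𝒰 a b := by
  obtain ⟨hK, ⟨U, hU, hs⟩, hσ, hn, hsσ, ha, hb⟩ := h
  have hsub : ((s.erase x : Finset X) : Set X) ⊆ s := Finset.coe_subset.2 (Finset.erase_subset x s)
  refine ⟨?_, ⟨U, hU, hsub.trans hs⟩, hσ, hn, hsub.trans hsσ, ?_, hb⟩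
  · rcases (s.erase x).eq_empty_or_nonempty with h | h
    · exact Or.inl h
    · refine Or.inr ((K.isRelLowerSet_faces (hK.resolve_left ?_)).2 (Finset.erase_subset x s) h)
      exact Finset.ne_empty_of_mem hx
  · rw [Finset.card_erase_of_mem hx]
    exact Nat.sub_eq_of_eq_add ha

theorem erase_right_mem_pairs [DecidableEq (Set X)] {a b : ℕ} {s : Finset X} {σ : Finset (Set X)}
    (h : (s, σ) ∈ pairs K 𝒰 a (b + 1)) {U : Set X} (hU : U ∈ σ) :
    (s, σ.erase U) ∈ pairs K 𝒰 a b := by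
  obtain ⟨hK, hs, hσ, hn, hsσ, ha, hb⟩ := h
  have hsub : ((σ.erase U : Finset (Set X)) : Set (Set X)) ⊆ σ :=
    Finset.coe_subset.2 (Finset.erase_subset U σ)
  refine ⟨hK, hs, hsub.trans hσ, hn.mono (Set.sInter_subset_sInter hsub),
    hsσ.trans (Set.sInter_subset_sInter hsub), ha, ?_⟩
  rw [Finset.card_erase_of_mem hU]
  exact Nat.sub_eq_of_eq_add hb

theorem pairs_empty_left {b : ℕ} :
    {σ | ((∅ : Finset X), σ) ∈ pairs K 𝒰 0 (b + 1)} =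
      {σ | σ ∈ (nerve 𝒰).faces ∧ σ.card = b + 1} := by
  ext σ
  constructor
  · rintro ⟨-, -, hσ, hn, -, -, hb⟩
    exact ⟨⟨Finset.card_pos.1 (Nat.lt_of_lt_of_eq b.succ_pos hb.symm), hσ, hn⟩, hb⟩
  · rintro ⟨⟨⟨U, hU⟩, hσ, hn⟩, hb⟩
    exact ⟨Or.inl rfl, ⟨U, hσ hU, by simp⟩, hσ, hn, by simp, rfl, hb⟩

variable [Preorder T] {Kf : T →o AbstractSimplicialComplex X}

/-- For `σ = ∅` the inclusion `s ⊆ ⋂₀ σ` is vacuous, and the condition that `s` lies in a member of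
`𝒰` is what cuts out the cover complex. -/
theorem pairs_empty_right {a : ℕ} {t : T} :
    {s | (s, (∅ : Finset (Set X))) ∈ pairs (Kf t) 𝒰 (a + 1) 0} =
      {s | s ∈ (coverComplex Kf 𝒰 t).faces ∧ s.card = a + 1} := by
  ext s
  constructor
  · rintro ⟨hK, hs, -, -, -, ha, -⟩
    refine ⟨⟨hK.resolve_left ?_, hs⟩, ha⟩
    rintro rfl
    exact a.succ_ne_zero ha.symm
  · rintro ⟨⟨hK, hs⟩, ha⟩
    -- A vertex of `s` shows that `⋂₀ ∅`, the whole of `X`, is nonempty.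
    obtain ⟨x, -⟩ := ((Kf t).isRelLowerSet_faces hK).1
    exact ⟨Or.inr hK, hs, by simp, ⟨x, by simp⟩, by simp, ha, rfl⟩

variable (𝕜 : Type w) [Field 𝕜]

/-- The filtered double complex of a cover, augmented in both directions. -/
def coverDoubleComplex (K : T →o AbstractSimplicialComplex X) (𝒰 : Set (Set X)) :
    FilteredDoubleComplex 𝕜 T (Finset X × Finset (Set X) →₀ 𝕜) where
  dL := boundaryLeft 𝕜 X (Set X)
  dR := boundaryRight 𝕜 X (Set X)
  part t a b := Finsupp.supported 𝕜 𝕜 (pairs (K t) 𝒰 a b)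
  part_mono _ _ h := Finsupp.supported_mono fun _ hp =>
    ⟨hp.1.imp_right fun hs => K.monotone h hs, hp.2⟩
  dL_dL := boundaryLeft_boundaryLeft
  dR_dR := boundaryRight_boundaryRight
  dL_dR := boundaryLeft_boundaryRight
  dL_mem := by
    classical
    exact boundaryLeft_mem_supported fun _ _ h _ hx => erase_left_mem_pairs h hx
  dR_mem := by
    classical
    exact boundaryRight_mem_supported fun _ _ h _ hx => erase_right_mem_pairs h hx
  dL_eq_zero {t b z} hz := by
    classical
    have := boundaryLeft_mem_supported (S' := ∅) (fun s σ h x hx => absurd hx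
      (Finset.eq_empty_iff_forall_notMem.1 (Finset.card_eq_zero.1 h.2.2.2.2.2.1) x)) hz
    simpa [Finsupp.supported_empty] using this
  dR_eq_zero {t a z} hz := by
    classical
    have := boundaryRight_mem_supported (S' := ∅) (fun s σ h x hx => absurd hx
      (Finset.eq_empty_iff_forall_notMem.1 (Finset.card_eq_zero.1 h.2.2.2.2.2.2) x)) hz
    simpa [Finsupp.supported_empty] using this

/-- For fixed `s`, a member `U` of `𝒰` containing `s` is an apex: adjoining it to `σ` keeps `s`
inside the intersection. As `s` is nonempty, the enlarged family still has a common point. -/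
theorem coverDoubleComplex_rightExact (K : T →o AbstractSimplicialComplex X) (𝒰 : Set (Set X)) :
    (coverDoubleComplex 𝕜 K 𝒰).RightExact := by
  classical
  intro t a b z hz h0
  refine exists_boundaryRight_eq (fun s m hm hm0 => ?_) hz h0
  by_cases hs : ∃ U ∈ 𝒰, (s : Set X) ⊆ U
  · obtain ⟨U, hU, hsU⟩ := hs
    refine ⟨cone 𝕜 U m, cone_mem_supported 𝕜 U ?_ hm, ?_⟩
    · rintro σ ⟨hK, hs, hσ, hn, hsσ, ha, hb⟩ hUσ
      have hsub : (s : Set X) ⊆ ⋂₀ ((insert U σ : Finset (Set X)) : Set (Set X)) := by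
        rw [Finset.coe_insert, Set.sInter_insert]
        exact Set.subset_inter hsU hsσ
      refine ⟨hK, hs, ?_, ?_, hsub, ha, ?_⟩
      · rw [Finset.coe_insert]
        exact Set.insert_subset hU hσ
      · have : s.Nonempty := Finset.card_pos.1 (Nat.lt_of_lt_of_eq a.succ_pos ha.symm)
        exact (Finset.coe_nonempty.2 this).mono hsub
      · rw [Finset.card_insert_of_notMem hUσ]
        exact congrArg (· + 1) hb
    · have := boundary_cone 𝕜 U m
      rwa [hm0, map_zero, add_zero] at this
  · have : {σ | (s, σ) ∈ pairs (K t) 𝒰 (a + 1) b} = ∅ :=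
      Set.eq_empty_of_forall_notMem fun σ h => hs h.2.1
    rw [this, Finsupp.supported_empty, Submodule.mem_bot] at hm
    exact ⟨0, Submodule.zero_mem _, by rw [map_zero, hm]⟩

/-- The filtration levels of a staircase: no shift in the first step, a shift by `α` in each
further step. -/
def stairLevel (α : T → T) (t : T) (i : ℕ) : T := α^[i - 1] t

theorem coverDoubleComplex_leftExact {K : T →o AbstractSimplicialComplex X} {𝒰 : Set (Set X)}
    {α : T → T} (hacyclic : ∀ V ∈ interClosure 𝒰, AlphaAcyclic 𝕜 α (restriction K V)) (t : T) :
    (coverDoubleComplex 𝕜 K 𝒰).LeftExact (stairLevel α t) := by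
  classical
  intro i b z hz h0
  refine exists_boundaryLeft_eq (fun σ m hm hm0 => ?_) hz h0
  by_cases hσ : (σ : Set (Set X)) ⊆ 𝒰 ∧ (⋂₀ (σ : Set (Set X))).Nonempty ∧ σ.card = b + 1
  swap
  · have : {s | (s, σ) ∈ pairs (K (stairLevel α t i)) 𝒰 i (b + 1)} = ∅ :=
      Set.eq_empty_of_forall_notMem fun s h => hσ ⟨h.2.2.1, h.2.2.2.1, h.2.2.2.2.2.2⟩
    rw [this, Finsupp.supported_empty, Submodule.mem_bot] at hm
    exact ⟨0, Submodule.zero_mem _, by rw [map_zero, hm]⟩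
  obtain ⟨hσ, hn, hb⟩ := hσ
  obtain ⟨U, hU⟩ : σ.Nonempty := Finset.card_pos.1 (Nat.lt_of_lt_of_eq b.succ_pos hb.symm)
  have hsU : ∀ s : Finset X, (s : Set X) ⊆ ⋂₀ (σ : Set (Set X)) → ∃ U ∈ 𝒰, (s : Set X) ⊆ U :=
    fun s hs => ⟨U, hσ hU, hs.trans (Set.sInter_subset_of_mem hU)⟩
  cases i with
  -- The chain is a multiple of `∅`. Coning it from a common point of `σ` uses only a vertex, which
  -- is present at every level, so levels `0` and `1` of `stairLevel` agree.
  | zero =>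
    obtain ⟨x, hx⟩ := hn
    refine ⟨cone 𝕜 x m, cone_mem_supported 𝕜 x ?_ hm, ?_⟩
    · intro s hs _
      obtain rfl : s = ∅ := Finset.card_eq_zero.1 hs.2.2.2.2.2.1
      have hxσ : ((insert x ∅ : Finset X) : Set X) ⊆ ⋂₀ (σ : Set (Set X)) := by simpa using hx
      exact ⟨Or.inr ((K _).singleton_mem x), hsU _ hxσ, hσ, ⟨x, hx⟩, hxσ, rfl, hb⟩
    · have := boundary_cone 𝕜 x m
      rwa [hm0, map_zero, add_zero] at this
  | succ q =>
    -- Cardinality `q + 1` is degree `q`; acyclicity is applied to `V = ⋂₀ σ`.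
    obtain ⟨y, hy, rfl⟩ := hacyclic _ ⟨_, hσ, ⟨U, hU⟩, rfl⟩ (stairLevel α t (q + 1)) q m
      (Finsupp.supported_mono (fun s hs => by
        obtain ⟨hK, -, -, -, hsσ, ha, -⟩ := hs
        refine ⟨⟨hK.resolve_left ?_, _, rfl, hsσ⟩, ha⟩
        rintro rfl
        exact q.succ_ne_zero ha.symm) hm) hm0
    have hα : α (stairLevel α t (q + 1)) = stairLevel α t (q + 1 + 1) :=
      (Function.iterate_succ_apply' α q t).symm
    rw [hα] at hy
    refine ⟨y, Finsupp.supported_mono (fun s hs => ?_) hy, rfl⟩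
    obtain ⟨⟨hK, _, rfl, hsσ⟩, ha⟩ := hs
    exact ⟨Or.inr hK, hsU s hsσ, hσ, hn, hsσ, ha, hb⟩

/-! ### Staircases between chains of the nerve and of the cover complex -/

variable {𝕜} {t : T} {k : ℕ}

theorem tensorRight_mem_part_iff {n : Finset (Set X) →₀ 𝕜} :
    tensorRight 𝕜 (Set X) ∅ n ∈ (coverDoubleComplex 𝕜 Kf 𝒰).part t 0 (k + 1) ↔
      n ∈ chains 𝕜 (nerve 𝒰) k := by
  rw [chains, ← pairs_empty_left (K := Kf t)]
  exact tensorRight_mem_supported_iff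

theorem tensorLeft_mem_part_iff {x : Finset X →₀ 𝕜} :
    tensorLeft 𝕜 X ∅ x ∈ (coverDoubleComplex 𝕜 Kf 𝒰).part t (k + 1) 0 ↔
      x ∈ chains 𝕜 (coverComplex Kf 𝒰 t) k := by
  rw [chains, ← pairs_empty_right]
  exact tensorLeft_mem_supported_iff

theorem exists_tensorRight_eq_of_mem_part {z : Finset X × Finset (Set X) →₀ 𝕜}
    (hz : z ∈ (coverDoubleComplex 𝕜 Kf 𝒰).part t 0 (k + 1)) :
    ∃ n ∈ chains 𝕜 (nerve 𝒰) k, tensorRight 𝕜 (Set X) ∅ n = z := by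
  obtain ⟨n, rfl⟩ := exists_tensorRight_eq
    (fun p hp => Finset.card_eq_zero.1 hp.2.2.2.2.2.1) hz
  exact ⟨n, tensorRight_mem_part_iff.1 hz, rfl⟩

theorem exists_tensorLeft_eq_of_mem_part {z : Finset X × Finset (Set X) →₀ 𝕜}
    (hz : z ∈ (coverDoubleComplex 𝕜 Kf 𝒰).part t (k + 1) 0) :
    ∃ x ∈ chains 𝕜 (coverComplex Kf 𝒰 t) k, tensorLeft 𝕜 X ∅ x = z := by
  have := tensorLeft_sliceLeft (fun p hp => Finset.card_eq_zero.1 hp.2.2.2.2.2.2) hz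
  exact ⟨_, tensorLeft_mem_part_iff.1 (this.symm ▸ hz), this⟩

variable (𝕜) in
/-- The linear relation between `k`-chains of the nerve and of the cover complex given by the
staircases with filtration levels `L`. -/
def stairRelation (K : T →o AbstractSimplicialComplex X) (𝒰 : Set (Set X)) (L : ℕ → T) (k : ℕ) :
    Submodule 𝕜 ((Finset (Set X) →₀ 𝕜) × (Finset X →₀ 𝕜)) where
  carrier := {p | (coverDoubleComplex 𝕜 K 𝒰).Zigzag L (k + 1) 0
    (tensorRight 𝕜 (Set X) ∅ p.1) (tensorLeft 𝕜 X ∅ p.2)}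
  add_mem' h h' := by
    simpa only [Set.mem_ofPred_eq, Prod.fst_add, Prod.snd_add, map_add] using h.add h'
  zero_mem' := by
    simpa only [Set.mem_ofPred_eq, Prod.fst_zero, Prod.snd_zero, map_zero] using
      FilteredDoubleComplex.Zigzag.zero
  smul_mem' c _ h := by
    simpa only [Set.mem_ofPred_eq, Prod.smul_fst, Prod.smul_snd, map_smul] using h.smul c

theorem stairRelation_mono {L L' : ℕ → T} (h : ∀ j ≤ k + 1, L j ≤ L' j) :
    stairRelation 𝕜 Kf 𝒰 L k ≤ stairRelation 𝕜 Kf 𝒰 L' k :=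
  fun _ hp => FilteredDoubleComplex.Zigzag.mono (fun j hj => h j (by omega)) hp

theorem boundary_eq_zero_of_mem_stairRelation {L : ℕ → T} (hk : k ≠ 0)
    {n : Finset (Set X) →₀ 𝕜} {x : Finset X →₀ 𝕜} (h : (n, x) ∈ stairRelation 𝕜 Kf 𝒰 L k) :
    boundary 𝕜 (Set X) n = 0 ∧ boundary 𝕜 X x = 0 := by
  obtain ⟨k, rfl⟩ := Nat.exists_eq_succ_of_ne_zero hk
  have h : (coverDoubleComplex 𝕜 Kf 𝒰).Zigzag L (k + 2) 0
    (tensorRight 𝕜 (Set X) ∅ n) (tensorLeft 𝕜 X ∅ x) := h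
  have hn := h.dR_left
  have hx := h.dL_right hn
  exact ⟨tensorRight_injective _ ((boundaryRight_tensorRight _ _).symm.trans
      (hn.trans (map_zero _).symm)),
    tensorLeft_injective _ ((boundaryLeft_tensorLeft _ _).symm.trans
      (hx.trans (map_zero _).symm))⟩

theorem exists_stairRelation_of_mem_cycles_nerve {α : T → T} (hle : ∀ t, t ≤ α t)
    (hacyclic : ∀ V ∈ interClosure 𝒰, AlphaAcyclic 𝕜 α (restriction Kf V)) (t : T)
    {n : Finset (Set X) →₀ 𝕜} (hn : n ∈ cycles 𝕜 (nerve 𝒰) k) :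
    ∃ x ∈ cycles 𝕜 (coverComplex Kf 𝒰 (α^[k + 1] t)) k,
      (n, x) ∈ stairRelation 𝕜 Kf 𝒰 (stairLevel α t) k := by
  rw [mem_cycles_iff] at hn
  have hn' := tensorRight_mem_part_iff (Kf := Kf) (t := stairLevel α t 0).2 hn.1
  obtain ⟨z, hz, h⟩ := (coverDoubleComplex_leftExact 𝕜 hacyclic t).exists_zigzag hn'
    ((coverDoubleComplex 𝕜 Kf 𝒰).dL_eq_zero hn') fun hk => by
      refine (boundaryRight_tensorRight _ _).trans ?_
      rw [hn.2 (by omega), map_zero]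
  rw [Nat.zero_add] at hz
  obtain ⟨x, hx, rfl⟩ := exists_tensorLeft_eq_of_mem_part hz
  -- The staircase itself ends at level `α^k t`; the last shift is spent only on boundaries.
  have hl : stairLevel α t (k + 1) ≤ α^[k + 1] t := by
    rw [Function.iterate_succ_apply']
    exact hle _
  exact ⟨x, mem_cycles_iff.2 ⟨chains_mono 𝕜 ((coverComplex Kf 𝒰).monotone hl) k hx,
    fun hk => (boundary_eq_zero_of_mem_stairRelation hk h).2⟩, h⟩

/-- The bounding chain lies one step beyond the staircase, at `stairLevel α t (k + 2)`, which is
`α^[k + 1] t`. This determines the exponent in the interleaving. -/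
theorem mem_boundaries_coverComplex_of_stairRelation {α : T → T}
    (hacyclic : ∀ V ∈ interClosure 𝒰, AlphaAcyclic 𝕜 α (restriction Kf V))
    {n : Finset (Set X) →₀ 𝕜} {x : Finset X →₀ 𝕜}
    (h : (n, x) ∈ stairRelation 𝕜 Kf 𝒰 (stairLevel α t) k) (hn : n ∈ boundaries 𝕜 (nerve 𝒰) k) :
    x ∈ boundaries 𝕜 (coverComplex Kf 𝒰 (α^[k + 1] t)) k := by
  obtain ⟨e, he, rfl⟩ := hn
  have he' := tensorRight_mem_part_iff (Kf := Kf) (t := stairLevel α t 0).2 he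
  obtain ⟨y, hy, hyx⟩ := (coverDoubleComplex_leftExact 𝕜 hacyclic t).exists_dL_eq h he'
    ((coverDoubleComplex 𝕜 Kf 𝒰).dL_eq_zero he') (boundaryRight_tensorRight _ _)
  rw [Nat.zero_add] at hy
  obtain ⟨y, hyc, rfl⟩ := exists_tensorLeft_eq_of_mem_part hy
  exact ⟨y, hyc, tensorLeft_injective _ ((boundaryLeft_tensorLeft _ _).symm.trans hyx)⟩

theorem exists_stairRelation_of_mem_cycles_coverComplex {x : Finset X →₀ 𝕜}
    (hx : x ∈ cycles 𝕜 (coverComplex Kf 𝒰 t) k) :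
    ∃ n ∈ cycles 𝕜 (nerve 𝒰) k, (n, x) ∈ stairRelation 𝕜 Kf 𝒰 (fun _ => t) k := by
  rw [mem_cycles_iff] at hx
  have hx' := tensorLeft_mem_part_iff.2 hx.1
  obtain ⟨z, hz, h⟩ := (coverDoubleComplex_rightExact 𝕜 Kf 𝒰).exists_zigzag hx'
    ((coverDoubleComplex 𝕜 Kf 𝒰).dR_eq_zero hx') (fun hk => by
      refine (boundaryLeft_tensorLeft _ _).trans ?_
      rw [hx.2 (by omega), map_zero]) rfl
  rw [Nat.zero_add] at hz h
  obtain ⟨n, hn, rfl⟩ := exists_tensorRight_eq_of_mem_part hz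
  replace h : (n, x) ∈ stairRelation 𝕜 Kf 𝒰 (fun _ => t) k := h
  exact ⟨n, mem_cycles_iff.2
    ⟨hn, fun hk => (boundary_eq_zero_of_mem_stairRelation hk h).1⟩, h⟩

theorem mem_boundaries_nerve_of_stairRelation {n : Finset (Set X) →₀ 𝕜} {x : Finset X →₀ 𝕜}
    (h : (n, x) ∈ stairRelation 𝕜 Kf 𝒰 (fun _ => t) k)
    (hx : x ∈ boundaries 𝕜 (coverComplex Kf 𝒰 t) k) : n ∈ boundaries 𝕜 (nerve 𝒰) k := by
  obtain ⟨y, hy, rfl⟩ := hx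
  obtain ⟨e, he, hen⟩ := (coverDoubleComplex_rightExact 𝕜 Kf 𝒰).exists_dR_eq h
    (tensorLeft_mem_part_iff.2 hy) (boundaryLeft_tensorLeft _ _)
  obtain ⟨e, hec, rfl⟩ := exists_tensorRight_eq_of_mem_part he
  exact ⟨e, hec, tensorRight_injective _ ((boundaryRight_tensorRight _ _).symm.trans hen)⟩

end Cover

end CoverNerve

end

/-! ### The interleaving -/

theorem mainTheorem3 {𝕜 : Type w} [Field 𝕜] {X : Type u} {T : Type v} [LinearOrder T] [OrderBot T]
    (K : T →o AbstractSimplicialComplex X) (𝒰 : Set (Set X)) (h𝒰 : ⋃₀ 𝒰 = Set.univ)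
    (α : T → T) (hα : Monotone α) (hle : ∀ t, t ≤ α t)
    (hacyclic : ∀ V ∈ CoverNerve.interClosure 𝒰,
      CoverNerve.AlphaAcyclic 𝕜 α (CoverNerve.restriction K V))
    (k : ℕ) :
    CoverNerve.Interleaved (α^[k + 1]) id
      (CoverNerve.persistentHomology 𝕜 (OrderHom.const T (CoverNerve.nerve 𝒰)) k)
      (CoverNerve.persistentHomology 𝕜 (CoverNerve.coverComplex K 𝒰) k) := by
  open CoverNerve in
  have hit : ∀ i t, t ≤ α^[i] t := fun i t => Function.id_le_iterate_of_id_le hle i t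
  have hmono : Monotone fun i => α^[i] := Function.monotone_iterate_of_id_le hle
  choose F hF using fun t => Subquotient.exists_map_of_relation (cycles 𝕜 (nerve 𝒰) k)
    (boundaries 𝕜 (nerve 𝒰) k) _ _ (stairRelation 𝕜 K 𝒰 (stairLevel α t) k)
    (fun _ => exists_stairRelation_of_mem_cycles_nerve hle hacyclic t)
    (fun _ _ => mem_boundaries_coverComplex_of_stairRelation hacyclic)
  choose G hG using fun t => Subquotient.exists_map_of_relation
    (cycles 𝕜 (coverComplex K 𝒰 t) k) (boundaries 𝕜 (coverComplex K 𝒰 t) k)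
    (cycles 𝕜 (nerve 𝒰) k) (boundaries 𝕜 (nerve 𝒰) k)
    -- The relation is read from the cover complex to the nerve, with all steps at level `t`.
    ((stairRelation 𝕜 K 𝒰 (fun _ => t) k).comap (LinearEquiv.prodComm 𝕜 _ _).toLinearMap)
    (fun _ => exists_stairRelation_of_mem_cycles_coverComplex)
    (fun _ _ => mem_boundaries_nerve_of_stairRelation)
  refine ⟨hα.iterate _, monotone_id, fun t => hit _ t, fun t => hit _ t,
    { app := fun t => ModuleCat.ofHom (F t), naturality := fun s t f => ?_ },
    { app := fun t => ModuleCat.ofHom (G t), naturality := fun s t f => ?_ },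
    fun t => ?_, fun t => ?_⟩
  · refine ModuleCat.hom_ext (LinearMap.ext fun z => ?_)
    obtain ⟨⟨n, hn⟩, rfl⟩ := Submodule.Quotient.mk_surjective _ z
    obtain ⟨x, hx, h⟩ := exists_stairRelation_of_mem_cycles_nerve hle hacyclic s hn
    have h1 := hF s ⟨n, hn⟩ ⟨x, hx⟩ h
    -- Naturality: by monotonicity of `α`, the staircase at `s` is also one at `t`.
    have h2 := hF t ⟨n, hn⟩
      ⟨x, cycles_mono 𝕜 ((coverComplex K 𝒰).monotone (hα.iterate (k + 1) f.le)) k hx⟩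
      (stairRelation_mono (fun j _ => hα.iterate (j - 1) f.le) h)
    exact h2.trans (congrArg (homologyMap 𝕜
      ((coverComplex K 𝒰).monotone (hα.iterate (k + 1) f.le)) k) h1).symm
  · refine ModuleCat.hom_ext (LinearMap.ext fun z => ?_)
    obtain ⟨⟨x, hx⟩, rfl⟩ := Submodule.Quotient.mk_surjective _ z
    obtain ⟨n, hn, h⟩ := exists_stairRelation_of_mem_cycles_coverComplex hx
    have h1 := hG s ⟨x, hx⟩ ⟨n, hn⟩ h
    have h2 := hG t ⟨x, cycles_mono 𝕜 ((coverComplex K 𝒰).monotone f.le) k hx⟩ ⟨n, hn⟩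
      (stairRelation_mono (fun _ _ => f.le) h)
    exact h2.trans (congrArg (homologyMap 𝕜 (le_refl (nerve 𝒰)) k) h1).symm
  · refine ModuleCat.hom_ext (LinearMap.ext fun z => ?_)
    obtain ⟨⟨n, hn⟩, rfl⟩ := Submodule.Quotient.mk_surjective _ z
    obtain ⟨x, hx, h⟩ := exists_stairRelation_of_mem_cycles_nerve hle hacyclic t hn
    have h1 := hF t ⟨n, hn⟩ ⟨x, hx⟩ h
    -- All levels of the staircase for `F` are at most `α^[k + 1] t`, so it also computes `G` there.
    have h2 := hG (α^[k + 1] t) ⟨x, hx⟩ ⟨n, hn⟩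
      (stairRelation_mono (fun j hj => hmono (show j - 1 ≤ k + 1 by omega) t) h)
    exact (congrArg (G (α^[k + 1] t)) h1).trans h2
  · refine ModuleCat.hom_ext (LinearMap.ext fun z => ?_)
    obtain ⟨⟨x, hx⟩, rfl⟩ := Submodule.Quotient.mk_surjective _ z
    obtain ⟨n, hn, h⟩ := exists_stairRelation_of_mem_cycles_coverComplex hx
    have h1 := hG t ⟨x, hx⟩ ⟨n, hn⟩ h
    -- Conversely, a staircase at constant level `t` fits under the levels `stairLevel α t`, with
    -- its end `x` included into level `α^[k + 1] t`.
    have h2 := hF t ⟨n, hn⟩ ⟨x, cycles_mono 𝕜 ((coverComplex K 𝒰).monotone (hit (k + 1) t)) k hx⟩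
      (stairRelation_mono (fun j _ => hit (j - 1) t) h)
    exact (congrArg (F t) h1).trans h2
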